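/- Write $\bar x = x^{-1}$ and $\sigma(x) = x - \bar x$. Consider the square ice on the $n\times n$ grid with domain wall boundary conditions: a state is an orientation of all edges (including the $4n$ external ones) such that two edges enter and two edges leave every vertex of the grid, the external horizontal edges point inwards and the external vertical edges point outwards. The vertex in row $i$ and column $j$ (rows counted from the top, columns from the left) has spectral parameter $x = x_i/y_j$ and the following weight, where $a$ is a parameter common to all vertices: $\sigma(a^2)$ if its two horizontal edges both enter or both leave it; $\sigma(a x)$ if its horizontal edges both point right and its vertical edges both point up, or its horizontal edges both point left and its vertical edges both point down; $\sigma(a\bar x)$ if its horizontal edges both point left and its vertical edges both point up, or its horizontal edges both point right and its vertical edges both point down. The weight of a state is the product of the weights of its vertices, and the partition function $Z(n;\boldsymbol x,\boldsymbol y)$ is the sum of the weights of all states. For $\boldsymbol u = (u_1,\ldots,u_{2n})$ let $Z(n;\boldsymbol u)$ be $Z(n;\boldsymbol x,\boldsymbol y)$ with $x_i = u_{2i-1}$ and $y_i = u_{2i}$ for $i = 1,\ldots,n$. Let $P(n;\boldsymbol u)$ be the $2n\times 2n$ matrix whose rows are indexed, in increasing order, by the $2n$ integers $k$ with $1\le k\le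 3n-1$ and $3\nmid k$, whose columns are indexed by $\mu = 1,\ldots,2n$, and whose entry in row $k$ and column $\mu$ is $u_\mu^{3n-2k}$. Theorem. Let $a = e^{\mathrm i\pi/3}$ and let $u_1,\ldots,u_{2n}$ be nonzero complex numbers with $u_\mu^2\ne u_\nu^2$ for all $\mu<\nu$. Then $$Z(n;\boldsymbol u) = (-1)^{\frac{n(n-1)}{2}}\,\frac{\sigma(a)^n}{\prod_{1\le\mu<\nu\le 2n}\sigma(u_\mu\,\bar u_\nu)}\,\det P(n;\boldsymbol u).$$ -/

import Mathlib

open scoped BigOperators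

namespace SquareIce

/-- `σ(x) = x - x⁻¹`. -/
noncomputable def sigma (x : ℂ) : ℂ := x - x⁻¹

/-- An orientation of the edges of the `n × n` square grid with its `4 n` external edges.
Rows are numbered from the top and columns from the left, starting at `0`.
* `hor i j` (for `j = 0, …, n`) is the horizontal edge of row `i` just to the left of column `j`
  (for `j = n`: the external edge on the right); `true` means that it points to the right.
* `ver i j` (for `i = 0, …, n`) is the vertical edge of column `j` just above row `i`
  (for `i = n`: the external edge at the bottom); `true` means that it points upwards. -/
abbrev Orientation (n : ℕ) : Type :=
  (Fin n → Fin (n + 1) → Bool) × (Fin (n + 1) → Fin n → Bool)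

variable {n : ℕ}

/-- The edge to the left of the vertex `(i, j)` points to the right. -/
def Orientation.left (s : Orientation n) (i j : Fin n) : Bool := s.1 i j.castSucc

/-- The edge to the right of the vertex `(i, j)` points to the right. -/
def Orientation.right (s : Orientation n) (i j : Fin n) : Bool := s.1 i j.succ

/-- The edge above the vertex `(i, j)` points upwards. -/
def Orientation.top (s : Orientation n) (i j : Fin n) : Bool := s.2 i.castSucc j

/-- The edge below the vertex `(i, j)` points upwards. -/
def Orientation.bottom (s : Orientation n) (i j : Fin n) : Bool := s.2 i.succ j

/-- The number of edges that enter the tetravalent vertex `(i, j)`. -/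
def Orientation.inDegree (s : Orientation n) (i j : Fin n) : ℕ :=
  (if s.left i j then 1 else 0) + (if s.right i j then 0 else 1)
    + (if s.top i j then 0 else 1) + (if s.bottom i j then 1 else 0)

/-- States of square ice with domain wall boundary: two edges enter (so two edges leave) every
tetravalent vertex, the external horizontal edges point inwards, and the external vertical edges
point outwards. -/
def Orientation.IsState (s : Orientation n) : Prop :=
  (∀ i j, s.inDegree i j = 2) ∧
  (∀ i, s.1 i 0 = true) ∧ (∀ i, s.1 i (Fin.last n) = false) ∧
  (∀ j, s.2 0 j = true) ∧ (∀ j, s.2 (Fin.last n) j = false)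

instance : DecidablePred (Orientation.IsState (n := n)) := fun s => by
  unfold Orientation.IsState; infer_instance

/-- The Boltzmann weight of a vertex with spectral parameter `x` and orientations `l r t b` of
its left, right, top and bottom edges (`true`: right, or up). The six lines are the six vertices
obeying the ice rule; they correspond to the entries `1, -1, 0, 0, 0, 0` of an
alternating-sign matrix. Other orientations never occur in a state. -/
noncomputable def vertexWeight (a x : ℂ) (l r t b : Bool) : ℂ :=
  match l, r, t, b with
  | true, false, true, false => sigma (a ^ 2)
  | false, true, false, true => sigma (a ^ 2)
  | true, true, true, true => sigma (a * x)
  | false, false, false, false => sigma (a * x)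
  | false, false, true, true => sigma (a * x⁻¹)
  | true, true, false, false => sigma (a * x⁻¹)
  | _, _, _, _ => 0

/-- The weight of a state: the vertex in row `i` and column `j` has spectral parameter
`x i / y j`. -/
noncomputable def Orientation.weight (s : Orientation n) (a : ℂ) (x y : Fin n → ℂ) : ℂ :=
  ∏ i, ∏ j, vertexWeight a (x i / y j) (s.left i j) (s.right i j) (s.top i j) (s.bottom i j)

/-- The partition function `Z(n; x, y)` of square ice with domain wall boundary. -/
noncomputable def partitionFunction (n : ℕ) (a : ℂ) (x y : Fin n → ℂ) : ℂ :=
  ∑ s : Orientation n with s.IsState, s.weight a x y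

/-- `Z(n; u)` for `u = (u₁, …, u₂ₙ) = (x₁, y₁, x₂, y₂, …, xₙ, yₙ)`. -/
noncomputable def partitionFunctionCombined (n : ℕ) (a : ℂ) (u : Fin (2 * n) → ℂ) : ℂ :=
  partitionFunction n a (fun i => u ⟨2 * i.val, by omega⟩) (fun i => u ⟨2 * i.val + 1, by omega⟩)

/-- The (zero-based) `r`-th positive integer not divisible by `3`: `1, 2, 4, 5, 7, 8, …`. -/
def nonMultipleOfThree (r : ℕ) : ℕ := r + r / 2 + 1

/-- The `2n × 2n` matrix `P(n; u)`: its rows correspond to the integers `1 ≤ k ≤ 3n - 1` not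
divisible by `3`, in increasing order, and the entry in row `k` and column `μ` is
`u_μ ^ (3n - 2k)`. -/
noncomputable def matrixP (n : ℕ) (u : Fin (2 * n) → ℂ) : Matrix (Fin (2 * n)) (Fin (2 * n)) ℂ :=
  Matrix.of fun r μ => u μ ^ (3 * (n : ℤ) - 2 * (nonMultipleOfThree r.val : ℤ))

end SquareIce

namespace SquareIce

/-! The only property of `a` that is used is `a ^ 2 = a - 1`, hence `a ^ 3 = -1`. The formula is
proved after multiplication by its denominator, by induction on the size and Lagrange interpolation
in the first parameter `u 0`, the spectral parameter of the top row.

For size `n + 1` both sides are Laurent polynomials in `u 0` of fixed parity, with exponents between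
`-(3n + 1)` and `3n + 1`: the partition function contributes `n` (`isLaurent_partitionFunction`),
the denominator `2n + 1`. So agreement at `3n + 2` points with distinct squares suffices. At the `2n
+ 1` points `u 0 = u ν` both sides vanish, by antisymmetry. The other `n + 1` points are `u 0 = y /
a` with `y` a vertical parameter. By the Yang–Baxter equation `Z` is symmetric in the vertical
parameters (`partitionFunction_comp_perm`), so `y` may be taken to belong to the first column. Then
the corner vertex must be a turn, the first row and column freeze, and `Z` reduces to size `n`
(`partitionFunction_corner`). The determinant obeys the matching recursion (`det_matrixP_corner`);
the two agree because `σ(az) σ(z/a) σ(z) = z³ - z⁻³`. This works when the sixth powers of the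
parameters are distinct; continuity gives the rest. -/

/-! ### Transfer matrices: the partition function as a product over columns -/

/-- The entries of a product of matrices are sums over paths. -/
theorem list_prod_apply_eq_sum_paths {α R : Type*} [Fintype α] [DecidableEq α] [CommSemiring R]
    {m : ℕ} (M : Fin m → Matrix α α R) (p q : α) :
    (List.ofFn M).prod p q =
      ∑ w : Fin (m + 1) → α with w 0 = p ∧ w (Fin.last m) = q,
        ∏ i, M i (w i.castSucc) (w i.succ) := by
  induction m generalizing p with
  | zero =>
    rw [Finset.sum_filter, ← (Equiv.funUnique (Fin 1) α).symm.sum_comp]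
    have (x : α) : (Equiv.funUnique (Fin 1) α).symm x = fun _ => x := rfl
    simp only [List.ofFn_zero, List.prod_nil, Matrix.one_apply, this, Finset.univ_eq_empty,
      Finset.prod_empty, ite_and, Finset.sum_ite_eq', Finset.mem_univ, if_true]
  | succ m ih =>
    have h0 : Fin.last (m + 1) = (Fin.last m).succ := rfl
    rw [List.ofFn_succ, List.prod_cons, Matrix.mul_apply, Finset.sum_filter,
      ← (Fin.consEquiv (fun _ => α)).sum_comp, Fintype.sum_prod_type]
    symm
    rw [Finset.sum_eq_single p]
    · simp only [ih, Finset.sum_filter, Finset.mul_sum]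
      rw [Finset.sum_comm]
      refine Finset.sum_congr rfl fun w _ => ?_
      symm
      rw [Finset.sum_eq_single (w 0)]
      · simp only [Fin.consEquiv_apply, Fin.cons_zero, h0, Fin.cons_succ, true_and,
          Fin.prod_univ_succ, Fin.castSucc_zero, ← Fin.succ_castSucc, mul_ite, mul_zero]
      · intro k _ hk
        rw [if_neg fun h => hk h.1.symm, mul_zero]
      · simp
    · intro b _ hb
      simp [hb]
    · simp

/-- The weight of a column with vertical spectral parameter `y`, as a matrix indexed by the
orientations of the horizontal edges on its left and on its right. -/
noncomputable def columnMatrix {m : ℕ} (a : ℂ) (x : Fin m → ℂ) (y : ℂ) :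
    Matrix (Fin m → Bool) (Fin m → Bool) ℂ :=
  Matrix.of fun h h' => ∑ v : Fin (m + 1) → Bool with v 0 = true ∧ v (Fin.last m) = false,
    ∏ i, vertexWeight a (x i / y) (h i) (h' i) (v i.castSucc) (v i.succ)

theorem inDegree_eq_two_of_vertexWeight_ne_zero {n : ℕ} {a x : ℂ} (s : Orientation n) (i j : Fin n)
    (h : vertexWeight a x (s.left i j) (s.right i j) (s.top i j) (s.bottom i j) ≠ 0) :
    s.inDegree i j = 2 := by
  unfold Orientation.inDegree
  generalize s.left i j = l at *
  generalize s.right i j = r at *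
  generalize s.top i j = t at *
  generalize s.bottom i j = b at *
  revert h
  cases l <;> cases r <;> cases t <;> cases b <;> simp [vertexWeight]

/-- The four boundary conditions. -/
def Orientation.IsDomainWall {n : ℕ} (s : Orientation n) : Prop :=
  (∀ i, s.1 i 0 = true) ∧ (∀ i, s.1 i (Fin.last n) = false) ∧
  (∀ j, s.2 0 j = true) ∧ (∀ j, s.2 (Fin.last n) j = false)

instance {n : ℕ} : DecidablePred (Orientation.IsDomainWall (n := n)) := fun s => by
  unfold Orientation.IsDomainWall; infer_instance

/-- Orientations violating the ice rule somewhere have weight zero. Without that constraint the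
vertical edges of different columns can be summed independently. -/
theorem partitionFunction_eq_sum_isDomainWall (n : ℕ) (a : ℂ) (x y : Fin n → ℂ) :
    partitionFunction n a x y = ∑ s : Orientation n with s.IsDomainWall, s.weight a x y := by
  refine Finset.sum_subset_zero_on_sdiff ?_ ?_ fun _ _ => rfl
  · intro s hs
    simp only [Finset.mem_filter, Finset.mem_univ, true_and] at hs ⊢
    exact hs.2
  · intro s hs
    simp only [Finset.mem_sdiff, Finset.mem_filter, Finset.mem_univ, true_and] at hs
    by_contra h
    refine hs.2 ⟨fun i j => ?_, hs.1⟩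
    refine inDegree_eq_two_of_vertexWeight_ne_zero (a := a) (x := x i / y j) s i j ?_
    exact Finset.prod_ne_zero_iff.1 (Finset.prod_ne_zero_iff.1 h i (Finset.mem_univ _)) j
      (Finset.mem_univ _)

theorem partitionFunction_eq_list_prod (n : ℕ) (a : ℂ) (x y : Fin n → ℂ) :
    partitionFunction n a x y =
      (List.ofFn fun j => columnMatrix a x (y j)).prod (fun _ => true) (fun _ => false) := by
  rw [partitionFunction_eq_sum_isDomainWall, list_prod_apply_eq_sum_paths, Finset.sum_filter,
    Fintype.sum_prod_type,
    ← (Equiv.piComm fun (_ : Fin (n + 1)) (_ : Fin n) => Bool).sum_comp, Finset.sum_filter]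
  simp only [← Finset.sum_filter (p := fun v => Orientation.IsDomainWall (_, v))]
  refine Finset.sum_congr rfl fun h _ => ?_
  by_cases hh : h 0 = (fun _ => true) ∧ h (Fin.last n) = fun _ => false
  · rw [if_pos hh]
    simp only [columnMatrix, Matrix.of_apply]
    rw [Finset.prod_univ_sum]
    refine Finset.sum_equiv (Equiv.piComm fun (_ : Fin (n + 1)) (_ : Fin n) => Bool) ?_ ?_
    · intro v
      have h1 := fun i => congrFun hh.1 i
      have h2 := fun i => congrFun hh.2 i
      simp only [Finset.mem_filter, Finset.mem_univ, true_and, Fintype.mem_piFinset,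
        Orientation.IsDomainWall, Equiv.piComm_apply, Function.swap, h1, h2, forall_and,
        implies_true]
    · intro v _
      rw [Orientation.weight, Finset.prod_comm]
      rfl
  · rw [if_neg hh]
    refine Finset.sum_eq_zero fun v hv => ?_
    simp only [Finset.mem_filter, Finset.mem_univ, true_and] at hv
    exact (hh ⟨funext hv.1, funext hv.2.1⟩).elim

/-! ### Yang–Baxter equation and symmetry in the vertical parameters -/

/-- The weight of two horizontally adjacent vertices, as a matrix indexed by the orientations of
the edges above and below. -/
noncomputable def pairMatrix (a x y y' : ℂ) (l r : Bool) : Matrix (Bool × Bool) (Bool × Bool) ℂ :=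
  Matrix.of fun t b => ∑ m, vertexWeight a (x / y) l m t.1 b.1 * vertexWeight a (x / y') m r t.2 b.2

/-- The matrix that intertwines two adjacent columns. -/
noncomputable def crossMatrix (a z : ℂ) : Matrix (Bool × Bool) (Bool × Bool) ℂ :=
  Matrix.of fun t b =>
    if t = b then if t.1 = t.2 then sigma (a ^ 2 * z) else sigma (a ^ 2)
    else if t.1 = b.2 ∧ t.2 = b.1 then sigma z⁻¹ else 0

/-- The Yang–Baxter equation. -/
theorem crossMatrix_mul_pairMatrix {a x y y' : ℂ} (ha : a ≠ 0) (hx : x ≠ 0) (hy : y ≠ 0)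
    (hy' : y' ≠ 0) (l r : Bool) :
    crossMatrix a (y / y') * pairMatrix a x y y' l r =
      pairMatrix a x y' y l r * crossMatrix a (y / y') := by
  ext ⟨t, t'⟩ ⟨b, b'⟩
  simp only [Matrix.mul_apply, crossMatrix, pairMatrix, Matrix.of_apply, Fintype.sum_prod_type,
    Fintype.sum_bool]
  cases l <;> cases r <;> cases t <;> cases t' <;> cases b <;> cases b' <;>
    simp [vertexWeight, sigma] <;> field_simp <;> ring

/-- The crossing is pulled down through the rows one at a time, exchanging `y` and `y'` in each row
it passes. -/
theorem crossMatrix_mul_list_prod {m : ℕ} {a y y' : ℂ} {x : Fin m → ℂ} (ha : a ≠ 0)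
    (hx : ∀ i, x i ≠ 0) (hy : y ≠ 0) (hy' : y' ≠ 0) (l r : Fin m → Bool) :
    crossMatrix a (y / y') * (List.ofFn fun i => pairMatrix a (x i) y y' (l i) (r i)).prod =
      (List.ofFn fun i => pairMatrix a (x i) y' y (l i) (r i)).prod * crossMatrix a (y / y') := by
  induction m with
  | zero => simp
  | succ m ih =>
    rw [List.ofFn_succ, List.ofFn_succ, List.prod_cons, List.prod_cons, ← mul_assoc,
      crossMatrix_mul_pairMatrix ha (hx 0) hy hy', mul_assoc,
      ih (fun i => hx i.succ) (fun i => l i.succ) (fun i => r i.succ), mul_assoc]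

theorem columnMatrix_mul_apply {m : ℕ} (a y y' : ℂ) (x : Fin m → ℂ) (l r : Fin m → Bool) :
    (columnMatrix a x y * columnMatrix a x y') l r =
      (List.ofFn fun i => pairMatrix a (x i) y y' (l i) (r i)).prod (true, true) (false, false) := by
  rw [list_prod_apply_eq_sum_paths, Matrix.mul_apply, Finset.sum_filter,
    ← (Equiv.arrowProdEquivProdArrow (Fin (m + 1)) (fun _ => Bool) fun _ => Bool).symm.sum_comp]
  simp only [columnMatrix, pairMatrix, Matrix.of_apply, Finset.sum_mul_sum, Finset.sum_filter,
    Fintype.prod_sum]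
  rw [Fintype.sum_prod_type, Finset.sum_comm]
  refine Finset.sum_congr rfl fun v _ => ?_
  rw [Finset.sum_comm]
  refine Finset.sum_congr rfl fun w _ => ?_
  simp only [Equiv.arrowProdEquivProdArrow_symm_apply, Prod.mk.injEq, Finset.prod_mul_distrib]
  by_cases hv : v 0 = true ∧ v (Fin.last m) = false <;>
    by_cases hw : w 0 = true ∧ w (Fin.last m) = false
  · simp [hv, hw]
  · rw [if_neg fun h => hw ⟨h.1.2, h.2.2⟩]
    simp [hw]
  · rw [if_neg fun h => hv ⟨h.1.1, h.2.1⟩]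
    simp [hv]
  · rw [if_neg fun h => hv ⟨h.1.1, h.2.1⟩]
    simp [hv]

theorem columnMatrix_mul_comm {m : ℕ} {a y y' : ℂ} {x : Fin m → ℂ} (ha : a ≠ 0)
    (hx : ∀ i, x i ≠ 0) (hy : y ≠ 0) (hy' : y' ≠ 0) (h : sigma (a ^ 2 * (y / y')) ≠ 0) :
    columnMatrix a x y * columnMatrix a x y' = columnMatrix a x y' * columnMatrix a x y := by
  ext l r
  rw [columnMatrix_mul_apply, columnMatrix_mul_apply]
  -- At the domain wall boundary the crossing acts as a scalar: in row `(true, true)` and in column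
  -- `(false, false)` its only nonzero entry is the diagonal one, `sigma (a ^ 2 * (y / y'))`, which
  -- cancels.
  have := congrFun (congrFun (crossMatrix_mul_list_prod ha hx hy hy' l r) (true, true))
    (false, false)
  simp only [Matrix.mul_apply, crossMatrix, Matrix.of_apply, Fintype.sum_prod_type,
    Fintype.sum_bool] at this
  simp at this
  rw [mul_comm] at this
  exact mul_right_cancel₀ h this

theorem partitionFunction_comp_perm {n : ℕ} {a : ℂ} {x y : Fin n → ℂ} (ha : a ≠ 0)
    (hx : ∀ i, x i ≠ 0) (hy : ∀ i, y i ≠ 0)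
    (h : ∀ i j, i ≠ j → sigma (a ^ 2 * (y i / y j)) ≠ 0) (τ : Equiv.Perm (Fin n)) :
    partitionFunction n a x (y ∘ τ) = partitionFunction n a x y := by
  rw [partitionFunction_eq_list_prod, partitionFunction_eq_list_prod]
  have hp := Equiv.Perm.ofFn_comp_perm τ (fun j => columnMatrix a x (y j))
  have : (List.ofFn ((fun j => columnMatrix a x (y j)) ∘ τ)).prod =
      (List.ofFn (fun j => columnMatrix a x (y j))).prod := by
    refine hp.prod_eq' ?_
    rw [List.pairwise_ofFn]
    intro i j hij
    exact columnMatrix_mul_comm ha hx (hy _) (hy _) (h _ _ fun e => hij.ne (τ.injective e))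
  simp only [Function.comp_def] at this ⊢
  rw [this]

/-! ### Freezing of the corner -/

/-- Adds a frozen row on top and a frozen column on the left of a state. -/
def Orientation.addFrozen {n : ℕ} (s : Orientation n) : Orientation (n + 1) :=
  (Fin.cons (Fin.cons true fun _ => false) fun i => Fin.cons true (s.1 i),
    Fin.cons (fun _ => true) fun i => Fin.cons false (s.2 i))

/-- Removes the first row and the first column. -/
def Orientation.removeCorner {n : ℕ} (s : Orientation (n + 1)) : Orientation n :=
  (fun i j => s.1 i.succ j.succ, fun i j => s.2 i.succ j.succ)

theorem Orientation.removeCorner_addFrozen {n : ℕ} (s : Orientation n) :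
    s.addFrozen.removeCorner = s := rfl

theorem Orientation.IsState.addFrozen {n : ℕ} {s : Orientation n} (h : s.IsState) :
    s.addFrozen.IsState := by
  obtain ⟨h, hl, hr, ht, hb⟩ := h
  refine ⟨fun i j => ?_, fun i => ?_, fun i => ?_, fun j => ?_, fun j => ?_⟩
  · refine Fin.cases ?_ (fun i => ?_) i <;> refine Fin.cases ?_ (fun j => ?_) j
    · rfl
    · simp [Orientation.inDegree, Orientation.addFrozen, Orientation.left, Orientation.right,
        Orientation.top, Orientation.bottom, ht]
    · simp [Orientation.inDegree, Orientation.addFrozen, Orientation.left, Orientation.right,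
        Orientation.top, Orientation.bottom, hl]
    · exact h i j
  · refine Fin.cases ?_ (fun i => ?_) i <;> rfl
  · refine Fin.cases ?_ (fun i => ?_) i
    · rfl
    · exact hr i
  · rfl
  · refine Fin.cases ?_ (fun j => ?_) j
    · rfl
    · exact hb j

/-- Two edges already leave the vertex, so the other two must enter. -/
theorem Orientation.right_bottom_of_left_false {n : ℕ} {s : Orientation n} {i j : Fin n}
    (h : s.inDegree i j = 2) (hl : s.left i j = false) (ht : s.top i j = true) :
    s.right i j = false ∧ s.bottom i j = true := by
  unfold Orientation.inDegree at h
  revert h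
  rw [hl, ht]
  cases s.right i j <;> cases s.bottom i j <;> simp

/-- Two edges already enter the vertex, so the other two must leave. -/
theorem Orientation.right_bottom_of_left_true {n : ℕ} {s : Orientation n} {i j : Fin n}
    (h : s.inDegree i j = 2) (hl : s.left i j = true) (ht : s.top i j = false) :
    s.right i j = true ∧ s.bottom i j = false := by
  unfold Orientation.inDegree at h
  revert h
  rw [hl, ht]
  cases s.right i j <;> cases s.bottom i j <;> simp

/-- In a state whose corner vertex is a turn, the first row and column are frozen. -/
theorem Orientation.IsState.exists_addFrozen {n : ℕ} {s : Orientation (n + 1)} (h : s.IsState)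
    (h0 : s.right 0 0 = false) : ∃ t : Orientation n, t.IsState ∧ t.addFrozen = s := by
  obtain ⟨h, hl, hr, ht, hb⟩ := h
  have hb0 : s.bottom 0 0 = false := by
    have h1 := h 0 0
    have hl0 : s.left 0 0 = true := hl 0
    have ht0 : s.top 0 0 = true := ht 0
    unfold Orientation.inDegree at h1
    revert h1
    rw [hl0, ht0, h0]
    cases s.bottom 0 0 <;> simp
  have row : ∀ j : Fin (n + 1), s.1 0 j.succ = false := by
    intro j
    induction j using Fin.induction with
    | zero => exact h0
    | succ j ih => exact (right_bottom_of_left_false (h 0 j.succ) ih (ht _)).1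
  have col : ∀ i : Fin (n + 1), s.2 i.succ 0 = false := by
    intro i
    induction i using Fin.induction with
    | zero => exact hb0
    | succ i ih => exact (right_bottom_of_left_true (h i.succ 0) (hl _) ih).2
  have row' : ∀ j : Fin n, s.2 (Fin.succ 0) j.succ = true := fun j =>
    (right_bottom_of_left_false (h 0 j.succ) (row j.castSucc) (ht _)).2
  have col' : ∀ i : Fin n, s.1 i.succ (Fin.succ 0) = true := fun i =>
    (right_bottom_of_left_true (h i.succ 0) (hl _) (col i.castSucc)).1
  refine ⟨s.removeCorner, ⟨fun i j => h i.succ j.succ, col', fun i => hr i.succ, row',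
    fun j => hb j.succ⟩, ?_⟩
  refine Prod.ext ?_ ?_
  · funext i j
    refine Fin.cases ?_ (fun i => ?_) i <;> refine Fin.cases ?_ (fun j => ?_) j
    · exact (hl 0).symm
    · exact (row j).symm
    · exact (hl _).symm
    · rfl
  · funext i j
    refine Fin.cases ?_ (fun i => ?_) i
    · exact (ht j).symm
    · refine Fin.cases ?_ (fun j => ?_) j
      · exact (col i).symm
      · rfl

theorem Orientation.IsState.weight_addFrozen {n : ℕ} {s : Orientation n} (h : s.IsState) (a : ℂ)
    (x y : Fin (n + 1) → ℂ) :
    s.addFrozen.weight a x y =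
      sigma (a ^ 2) * (∏ j : Fin n, sigma (a * (x 0 / y j.succ)⁻¹)) *
        (∏ i : Fin n, sigma (a * (x i.succ / y 0)⁻¹)) *
          s.weight a (fun i => x i.succ) (fun j => y j.succ) := by
  obtain ⟨-, hl, -, ht, -⟩ := h
  simp only [Orientation.weight, Fin.prod_univ_succ (n := n), Finset.prod_mul_distrib]
  simp [Orientation.addFrozen, Orientation.left, Orientation.right,
        Orientation.top, Orientation.bottom, hl, ht, vertexWeight]
  ring

theorem sigma_one : sigma 1 = 0 := by simp [sigma]

/-- The recursion of the partition function where the corner vertex is forced to be a turn. -/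
theorem partitionFunction_corner {n : ℕ} {a : ℂ} {x y : Fin (n + 1) → ℂ}
    (h0 : a * (x 0 / y 0) = 1) :
    partitionFunction (n + 1) a x y =
      sigma (a ^ 2) * (∏ j : Fin n, sigma (a * (x 0 / y j.succ)⁻¹)) *
        (∏ i : Fin n, sigma (a * (x i.succ / y 0)⁻¹)) *
          partitionFunction n a (fun i => x i.succ) (fun j => y j.succ) := by
  rw [partitionFunction, partitionFunction, Finset.mul_sum]
  symm
  refine Finset.sum_of_injOn Orientation.addFrozen ?_ ?_ ?_ ?_
  · intro s _ t _ h
    rw [← s.removeCorner_addFrozen, h, t.removeCorner_addFrozen]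
  · intro s hs
    simp only [Finset.coe_filter, Finset.mem_univ, true_and, Set.mem_ofPred_eq] at hs ⊢
    exact hs.addFrozen
  · intro s hs hn
    simp only [Finset.mem_filter, Finset.mem_univ, true_and] at hs
    -- A state that is not frozen has no turn at the corner, whose weight is then `sigma (a * (x 0 /
    -- y 0)) = sigma 1 = 0`.
    refine Finset.prod_eq_zero (Finset.mem_univ 0) (Finset.prod_eq_zero (Finset.mem_univ 0) ?_)
    rcases hr : s.right 0 0 with _ | _
    · obtain ⟨t, ht, rfl⟩ := hs.exists_addFrozen hr
      exact (hn ⟨t, by simpa using ht, rfl⟩).elim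
    · have hl0 : s.left 0 0 = true := hs.2.1 0
      have ht0 : s.top 0 0 = true := hs.2.2.2.1 0
      rw [hl0, ht0]
      cases s.bottom 0 0 <;> simp [vertexWeight, h0, sigma_one]
  · intro s hs
    simp only [Finset.mem_filter, Finset.mem_univ, true_and] at hs
    exact (hs.weight_addFrozen a x y).symm

/-! ### Laurent polynomials of a fixed parity -/

open Polynomial in
/-- `f` is, away from `0`, a linear combination of `x ^ d, x ^ (d - 2), …, x ^ (-d)`. -/
def IsLaurent (d : ℕ) (f : ℂ → ℂ) : Prop :=
  ∃ p : ℂ[X], p.natDegree ≤ d ∧ ∀ x ≠ 0, x ^ d * f x = p.eval (x ^ 2)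

namespace IsLaurent

open Polynomial

theorem const (c : ℂ) : IsLaurent 0 fun _ => c := ⟨C c, by simp, by simp⟩

theorem zero (d : ℕ) : IsLaurent d fun _ => 0 := ⟨0, by simp, by simp⟩

theorem add {d : ℕ} {f g : ℂ → ℂ} (hf : IsLaurent d f) (hg : IsLaurent d g) :
    IsLaurent d fun x => f x + g x := by
  obtain ⟨p, hp, hp'⟩ := hf
  obtain ⟨q, hq, hq'⟩ := hg
  exact ⟨p + q, natDegree_add_le_of_degree_le hp hq,
    fun x hx => by rw [mul_add, hp' x hx, hq' x hx, eval_add]⟩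

theorem mul {d e : ℕ} {f g : ℂ → ℂ} (hf : IsLaurent d f) (hg : IsLaurent e g) :
    IsLaurent (d + e) fun x => f x * g x := by
  obtain ⟨p, hp, hp'⟩ := hf
  obtain ⟨q, hq, hq'⟩ := hg
  exact ⟨p * q, natDegree_mul_le_of_le hp hq,
    fun x hx => by rw [eval_mul, ← hp' x hx, ← hq' x hx]; ring⟩

theorem const_mul {d : ℕ} {f : ℂ → ℂ} (hf : IsLaurent d f) (c : ℂ) :
    IsLaurent d fun x => c * f x := by
  simpa using (const c).mul hf

theorem sub {d : ℕ} {f g : ℂ → ℂ} (hf : IsLaurent d f) (hg : IsLaurent d g) :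
    IsLaurent d fun x => f x - g x := by
  simpa [sub_eq_add_neg] using hf.add (hg.const_mul (-1))

theorem sum {ι : Type*} {d : ℕ} {f : ι → ℂ → ℂ} (s : Finset ι) (h : ∀ i ∈ s, IsLaurent d (f i)) :
    IsLaurent d fun x => ∑ i ∈ s, f i x := by
  classical
  induction s using Finset.induction_on with
  | empty => simpa using zero d
  | insert i s hi ih =>
    simp only [Finset.sum_insert hi]
    exact (h i (by simp)).add (ih fun j hj => h j (by simp [hj]))

theorem prod {ι : Type*} {d : ι → ℕ} {f : ι → ℂ → ℂ} (s : Finset ι)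
    (h : ∀ i ∈ s, IsLaurent (d i) (f i)) :
    IsLaurent (∑ i ∈ s, d i) fun x => ∏ i ∈ s, f i x := by
  classical
  induction s using Finset.induction_on with
  | empty => simpa using const 1
  | insert i s hi ih =>
    simp only [Finset.sum_insert hi, Finset.prod_insert hi]
    exact (h i (by simp)).mul (ih fun j hj => h j (by simp [hj]))

theorem linear (b c : ℂ) : IsLaurent 1 fun x => b * x + c * x⁻¹ := by
  refine ⟨C b * X + C c, natDegree_linear_le, fun x hx => ?_⟩
  simp only [eval_add, eval_mul, eval_C, eval_X]
  field_simp

theorem zpow {d : ℕ} (k : ℕ) (hk : k ≤ d) : IsLaurent d fun x => x ^ ((d : ℤ) - 2 * k) := by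
  refine ⟨X ^ (d - k), by simp, fun x hx => ?_⟩
  rw [eval_pow, eval_X, ← zpow_natCast, ← zpow_add₀ hx, ← pow_mul, ← zpow_natCast]
  congr 1
  omega

/-- A Laurent polynomial vanishes if it vanishes at too many points with distinct squares. -/
theorem eq_zero {d : ℕ} {f : ℂ → ℂ} (hf : IsLaurent d f) {ι : Type*} [Fintype ι] (z : ι → ℂ)
    (hcard : d < Fintype.card ι) (hz : ∀ i, z i ≠ 0) (hinj : Function.Injective fun i => z i ^ 2)
    (h : ∀ i, f (z i) = 0) {x : ℂ} (hx : x ≠ 0) : f x = 0 := by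
  obtain ⟨p, hp, hp'⟩ := hf
  have : p = 0 := eq_zero_of_natDegree_lt_card_of_eval_eq_zero p hinj
    (fun i => by rw [← hp' _ (hz i), h, mul_zero]) (hp.trans_lt hcard)
  have h1 := hp' x hx
  rw [this, eval_zero] at h1
  exact (mul_eq_zero.1 h1).resolve_left (pow_ne_zero _ hx)

end IsLaurent

/-- The top edge is `true` because only the first row is needed. A turn has constant weight, which
saves one degree. -/
theorem isLaurent_vertexWeight (a y : ℂ) (l r b : Bool) :
    IsLaurent (if l = true ∧ r = false then 0 else 1)
      fun x => vertexWeight a (x / y) l r true b := by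
  have h1 : IsLaurent 1 fun x => sigma (a * (x / y)) := by
    convert! IsLaurent.linear (a / y) (-(a / y)⁻¹) using 2 with x
    rw [sigma, mul_div_left_comm, mul_inv]
    ring
  have h2 : IsLaurent 1 fun x => sigma (a * (x / y)⁻¹) := by
    convert! IsLaurent.linear (-(a * y)⁻¹) (a * y) using 2 with x
    rw [sigma, inv_div, mul_inv, inv_div, mul_inv]
    ring
  cases l <;> cases r <;> cases b <;> simp only [vertexWeight, if_true, and_true, and_false,
    if_false, reduceCtorEq, IsLaurent.zero, IsLaurent.const, h1, h2]

/-- The partition function as a function of its first horizontal spectral parameter. -/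
theorem isLaurent_partitionFunction {n : ℕ} (a : ℂ) (x y : Fin (n + 1) → ℂ) :
    IsLaurent n fun t => partitionFunction (n + 1) a (Function.update x 0 t) y := by
  refine IsLaurent.sum _ fun s hs => ?_
  simp only [Finset.mem_filter, Finset.mem_univ, true_and] at hs
  simp only [Orientation.weight, Fin.prod_univ_succ (n := n) (f := fun i => ∏ j, _)]
  simp only [Function.update_self, Function.update_of_ne (Fin.succ_ne_zero _)]
  have htop : ∀ j, s.top 0 j = true := fun j => hs.2.2.2.1 j
  -- The top row starts pointing right and ends pointing left, and by the ice rule it never turns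
  -- back. It has exactly one turn, so the degree is `n`, not `n + 1`; the interpolation needs this
  -- sharp bound.
  obtain ⟨j, hj⟩ : ∃ j : Fin (n + 1), s.left 0 j = true ∧ s.right 0 j = false := by
    by_contra! h
    have : ∀ j : Fin (n + 2), s.1 0 j = true := by
      intro j
      induction j using Fin.induction with
      | zero => exact hs.2.1 0
      | succ j ih => exact Bool.eq_true_of_not_eq_false (h j ih)
    simpa [this] using hs.2.2.1 0
  have hanti : Antitone (s.1 0) := by
    rw [Fin.antitone_iff_succ_le]
    intro k
    rcases hk : s.1 0 k.castSucc with _ | _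
    · exact (Orientation.right_bottom_of_left_false (hs.1 0 k) hk (htop k)).1.le
    · exact Bool.le_true _
  have huniq : ∀ k : Fin (n + 1), s.left 0 k = true ∧ s.right 0 k = false → k = j := by
    intro k hk
    have aux : ∀ j k : Fin (n + 1), s.left 0 k = true → s.right 0 j = false → ¬ j < k := by
      intro j k hk hj hjk
      have := hanti (show j.succ ≤ k.castSucc from hjk)
      rw [show s.1 0 k.castSucc = true from hk, show s.1 0 j.succ = false from hj] at this
      exact absurd this (by decide)
    exact le_antisymm (not_lt.1 (aux j k hk.1 hj.2)) (not_lt.1 (aux k j hj.1 hk.2))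
  have hrow := IsLaurent.prod Finset.univ
    fun j _ => isLaurent_vertexWeight a (y j) (s.left 0 j) (s.right 0 j) (s.bottom 0 j)
  have hdeg : ∑ k : Fin (n + 1), (if s.left 0 k = true ∧ s.right 0 k = false then 0 else 1) = n := by
    have : ∀ k, (s.left 0 k = true ∧ s.right 0 k = false) ↔ k = j :=
      fun k => ⟨huniq k, fun h => h ▸ hj⟩
    simp only [this]
    rw [Finset.sum_ite, Finset.filter_not, Finset.filter_eq']
    simp [Finset.card_sdiff]
  rw [hdeg] at hrow
  simp only [htop]
  simpa using hrow.mul (IsLaurent.const _)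

/-! ### Products over pairs and the determinant of `P` -/

/-- `∏_{μ < ν} σ(u_μ / u_ν)`. -/
noncomputable def sigmaProd {m : ℕ} (u : Fin m → ℂ) : ℂ :=
  ∏ μ : Fin m, ∏ ν ∈ Finset.Ioi μ, sigma (u μ * (u ν)⁻¹)

theorem sigma_inv (x : ℂ) : sigma x⁻¹ = -sigma x := by simp [sigma]

theorem sigma_eq_zero_iff {x : ℂ} (hx : x ≠ 0) : sigma x = 0 ↔ x ^ 2 = 1 := by
  rw [sigma, sub_eq_zero, pow_two]
  constructor
  · intro h
    nth_rw 2 [h]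
    exact mul_inv_cancel₀ hx
  · exact eq_inv_of_mul_eq_one_left

theorem sigmaProd_comp_perm {m : ℕ} (u : Fin m → ℂ) (τ : Equiv.Perm (Fin m)) :
    sigmaProd (u ∘ τ) = (Equiv.Perm.sign τ : ℂ) * sigmaProd u :=
  τ.prod_Ioi_comp_eq_sign_mul_prod (f := fun i j => sigma (u i * (u j)⁻¹)) fun i j => by
    rw [← sigma_inv, mul_inv, inv_inv, mul_comm]

theorem sigmaProd_succ {m : ℕ} (u : Fin (m + 1) → ℂ) :
    sigmaProd u = (∏ ν : Fin m, sigma (u 0 * (u ν.succ)⁻¹)) * sigmaProd fun i => u i.succ := by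
  simp only [sigmaProd, Fin.prod_univ_succ (n := m) (f := fun i => ∏ j ∈ _, _), Fin.prod_Ioi_zero,
    Fin.prod_Ioi_succ]

theorem prod_fin_two_mul {M : Type*} [CommMonoid M] {n : ℕ} (f : Fin (2 * n) → M) :
    ∏ ν, f ν = (∏ i : Fin n, f ⟨2 * i.val, by omega⟩) *
      ∏ i : Fin n, f ⟨2 * i.val + 1, by omega⟩ := by
  induction n with
  | zero => simp
  | succ n ih =>
    refine (Fin.prod_univ_succ (n := 2 * n + 1) f).trans ?_
    rw [Fin.prod_univ_succ (n := 2 * n), ih fun i => f i.succ.succ, Fin.prod_univ_succ (n := n),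
      Fin.prod_univ_succ (n := n), ← mul_assoc, mul_mul_mul_comm]
    rfl

/-- Adding `c` times row `r` to row `r + 2`, for all `r` at once, is multiplication by the
unitriangular `L`. It clears the first two columns below their top `2 × 2` block, leaving a block
triangular matrix. -/
theorem det_eq_corner_mul {m : ℕ} (M : Matrix (Fin (m + 2)) (Fin (m + 2)) ℂ) (c : ℂ)
    (h0 : ∀ r : Fin m, M r.succ.succ 0 + c * M r.castSucc.castSucc 0 = 0)
    (h1 : ∀ r : Fin m, M r.succ.succ 1 + c * M r.castSucc.castSucc 1 = 0) :
    M.det = (M 0 0 * M 1 1 - M 1 0 * M 0 1) * (Matrix.of fun r s : Fin m =>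
      M r.succ.succ s.succ.succ + c * M r.castSucc.castSucc s.succ.succ).det := by
  let L : Matrix (Fin (m + 2)) (Fin (m + 2)) ℂ :=
    Matrix.of fun r s => (if s = r then 1 else 0) + if s.val + 2 = r.val then c else 0
  have hL : L.det = 1 := by
    rw [Matrix.det_of_isLowerTriangular]
    · simp [L]
    · intro i j hij
      have : i.val < j.val := hij
      have h1 : j ≠ i := fun e => by simp [e] at this
      have h2 : j.val + 2 ≠ i.val := by omega
      simp [L, h1, h2]
  have hrow : ∀ (r : Fin m) s, (L * M) r.succ.succ s =
      M r.succ.succ s + c * M r.castSucc.castSucc s := by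
    intro r s
    have : ∀ k : Fin (m + 2), k.val + 2 = r.succ.succ.val ↔ k = r.castSucc.castSucc := by
      intro k
      simp [Fin.ext_iff]
    simp only [Matrix.mul_apply, L, Matrix.of_apply, add_mul, Finset.sum_add_distrib, this]
    simp
  have hr0 : ∀ s, (L * M) 0 s = M 0 s := by
    intro s
    simp [Matrix.mul_apply, L]
  have hr1 : ∀ s, (L * M) 1 s = M 1 s := by
    intro s
    simp [Matrix.mul_apply, L]
  rw [← one_mul M.det, ← hL, ← Matrix.det_mul]
  have key : ∀ N : Matrix (Fin (m + 2)) (Fin (m + 2)) ℂ, (∀ r : Fin m, N r.succ.succ 0 = 0) →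
      (∀ r : Fin m, N r.succ.succ 1 = 0) → N.det = (N 0 0 * N 1 1 - N 1 0 * N 0 1) *
        (Matrix.of fun r s : Fin m => N r.succ.succ s.succ.succ).det := by
    intro N hN0 hN1
    rw [Matrix.det_succ_column_zero, Fin.sum_univ_succ, Fin.sum_univ_succ]
    rw [Matrix.det_succ_column_zero (N.submatrix _ _), Fin.sum_univ_succ,
      Matrix.det_succ_column_zero (N.submatrix _ _), Fin.sum_univ_succ]
    have hs : ∀ r : Fin m, (1 : Fin (m + 2)).succAbove r.succ = r.succ.succ := fun r => rfl
    simp only [Matrix.submatrix_apply, Fin.succAbove_zero, Matrix.submatrix_submatrix,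
      Fin.succ_zero_eq_one, hN0, hN1, hs, mul_zero, zero_mul, Finset.sum_const_zero, add_zero]
    have hA : N.submatrix (Fin.succ ∘ Fin.succ) (Fin.succ ∘ Fin.succ) =
        Matrix.of fun r s : Fin m => N r.succ.succ s.succ.succ := rfl
    have hB : N.submatrix ((1 : Fin (m + 2)).succAbove ∘ Fin.succ) (Fin.succ ∘ Fin.succ) =
        Matrix.of fun r s : Fin m => N r.succ.succ s.succ.succ := rfl
    have hC : (1 : Fin (m + 2)).succAbove 0 = 0 := rfl
    rw [hA, hB, hC]
    simp
    ring
  rw [key (L * M) (fun r => (hrow r 0).trans (h0 r)) (fun r => (hrow r 1).trans (h1 r))]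
  simp only [hrow, hr0, hr1]

/-- The recursion of the determinant at `u₂ = a u₁`. -/
theorem det_matrixP_corner {n : ℕ} {a : ℂ} (ha : a ^ 2 = a - 1) {u : Fin (2 * n + 2) → ℂ}
    (hu : ∀ μ, u μ ≠ 0) (h1 : u 1 = a * u 0) :
    (matrixP (n + 1) u).det = -((-1) ^ n * u 0 ^ (6 * n) * sigma a) *
      ((∏ ν : Fin (2 * n), ((u ν.succ.succ ^ 3)⁻¹ - (u 0 ^ 6)⁻¹ * u ν.succ.succ ^ 3)) *
        (matrixP n fun ν => u ν.succ.succ).det) := by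
  have ha0 : a ≠ 0 := by
    rintro rfl
    norm_num at ha
  have ha3 : a ^ 3 = -1 := by linear_combination (a + 1) * ha
  -- Two rows further down `k` grows by `3`, so the exponent drops by `6`. The two exponents lie `3`
  -- below and `3` above that of row `r` in the smaller matrix, and the combination is that row
  -- times a factor depending only on the column.
  have hstep : ∀ (r : Fin (2 * n)) (z : ℂ), z ≠ 0 →
      z ^ (3 * ((n + 1 : ℕ) : ℤ) - 2 * (nonMultipleOfThree r.succ.succ.val : ℤ)) +
        -(u 0 ^ 6)⁻¹ * z ^ (3 * ((n + 1 : ℕ) : ℤ) -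
          2 * (nonMultipleOfThree r.castSucc.castSucc.val : ℤ)) =
      ((z ^ 3)⁻¹ - (u 0 ^ 6)⁻¹ * z ^ 3) *
        z ^ (3 * (n : ℤ) - 2 * (nonMultipleOfThree r.val : ℤ)) := by
    intro r z hz
    have e1 : 3 * ((n + 1 : ℕ) : ℤ) - 2 * (nonMultipleOfThree r.succ.succ.val : ℤ) =
        3 * (n : ℤ) - 2 * (nonMultipleOfThree r.val : ℤ) - 3 := by
      simp only [nonMultipleOfThree, Fin.val_succ]
      omega
    have e2 : 3 * ((n + 1 : ℕ) : ℤ) - 2 * (nonMultipleOfThree r.castSucc.castSucc.val : ℤ) =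
        3 * (n : ℤ) - 2 * (nonMultipleOfThree r.val : ℤ) + 3 := by
      simp only [nonMultipleOfThree, Fin.val_castSucc]
      omega
    rw [e1, e2, zpow_sub₀ hz, zpow_add₀ hz]
    norm_cast
    ring
  -- The column factor vanishes when `z ^ 6 = u 0 ^ 6`, in particular for `z = u 0` and, since `a ^
  -- 6 = 1`, for `z = a * u 0`.
  have hzero : ∀ (r : Fin (2 * n)) (z : ℂ), z ≠ 0 → z ^ 6 = u 0 ^ 6 →
      z ^ (3 * ((n + 1 : ℕ) : ℤ) - 2 * (nonMultipleOfThree r.succ.succ.val : ℤ)) +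
        -(u 0 ^ 6)⁻¹ * z ^ (3 * ((n + 1 : ℕ) : ℤ) -
          2 * (nonMultipleOfThree r.castSucc.castSucc.val : ℤ)) = 0 := by
    intro r z hz hz6
    rw [hstep r z hz, ← hz6]
    have : (z ^ 3)⁻¹ - (z ^ 6)⁻¹ * z ^ 3 = 0 := by
      field_simp
      ring
    rw [this, zero_mul]
  have hu0 := hu 0
  refine (det_eq_corner_mul (matrixP (n + 1) u) (-(u 0 ^ 6)⁻¹) (fun r => ?_) (fun r => ?_)).trans ?_
  · exact hzero r _ (hu 0) rfl
  · refine hzero r _ (hu 1) ?_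
    rw [h1, mul_pow, show a ^ 6 = (a ^ 3) ^ 2 by ring, ha3]
    norm_num
  · congr 1
    · have e0 : (3 * ((n + 1 : ℕ) : ℤ) - 2 * (nonMultipleOfThree 0 : ℤ)) = 3 * n + 1 := by
        simp [nonMultipleOfThree]
        ring
      have e1 : (3 * ((n + 1 : ℕ) : ℤ) - 2 * (nonMultipleOfThree 1 : ℤ)) = 3 * n - 1 := by
        simp [nonMultipleOfThree]
        ring
      have : ∀ ν, matrixP (n + 1) u 0 ν = u ν ^ (3 * (n : ℤ) + 1) := fun ν => by
        rw [← e0]; rfl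
      rw [this, this]
      have : ∀ ν, matrixP (n + 1) u 1 ν = u ν ^ (3 * (n : ℤ) - 1) := fun ν => by
        rw [← e1]; rfl
      rw [this, this]
      have h1' : u (1 : Fin (2 * (n + 1))) = a * u 0 := h1
      rw [h1', mul_zpow, mul_zpow, zpow_add₀ hu0, zpow_sub₀ hu0, zpow_add₀ ha0, zpow_sub₀ ha0,
        zpow_mul, zpow_mul]
      simp only [zpow_ofNat, zpow_natCast]
      rw [ha3, sigma, show 6 * n = 3 * n + 3 * n by ring, pow_add, pow_mul]
      field_simp
      ring
    · rw [← Matrix.det_mul_row]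
      congr 1
      ext r s
      exact hstep r _ (hu _)

/-! ### The product formula without denominators -/

/-- The determinant formula for `Z(n; u)`, multiplied by its denominator. -/
def DeterminantFormula (a : ℂ) (n : ℕ) (u : Fin (2 * n) → ℂ) : Prop :=
  partitionFunctionCombined n a u * sigmaProd u =
    (-1) ^ (n * (n - 1) / 2) * sigma a ^ n * (matrixP n u).det

/-- Since `1`, `a ^ 2`, `a ^ (-2)` are the cube roots of unity, this is the factorization of `z ^ 6
- 1` over `z ^ 2`. -/
theorem sigma_mul_sigma_mul_sigma {a z : ℂ} (ha : a ^ 2 = a - 1) :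
    sigma (a * z) * sigma (z * a⁻¹) * sigma z = z ^ 3 - (z ^ 3)⁻¹ := by
  have ha0 : a ≠ 0 := by
    rintro rfl
    norm_num at ha
  have h : a⁻¹ = 1 - a := inv_eq_of_mul_eq_one_right (by linear_combination -ha)
  simp only [sigma, mul_inv, inv_inv, ← inv_pow]
  rw [h]
  linear_combination -((z ^ 2 + 2 * z * z⁻¹ + z⁻¹ ^ 2) * (z - z⁻¹)) * ha

theorem sign_step (n : ℕ) :
    (-1 : ℂ) ^ ((n + 1) * (n + 1 - 1) / 2) = (-1) ^ (n * (n - 1) / 2) * (-1) ^ n := by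
  rw [← pow_add]
  congr 1
  have := Finset.sum_range_succ (fun i => i) n
  rwa [Finset.sum_range_id, Finset.sum_range_id] at this

/-- Each remaining parameter `w` contributes `σ(az)` from the frozen edges and `σ(z/a) σ(z)` from
the denominator, with `z = u 1 / w`. Their product `z³ - z⁻³` is, up to `u 1 ^ 3`, the column factor
of the determinant. -/
theorem determinantFormula_corner {n : ℕ} {a : ℂ} (ha : a ^ 2 = a - 1) {u : Fin (2 * n + 2) → ℂ}
    (hu : ∀ μ, u μ ≠ 0) (h1 : u 1 = a * u 0)
    (h : DeterminantFormula a n fun ν => u ν.succ.succ) : DeterminantFormula a (n + 1) u := by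
  have ha0 : a ≠ 0 := by
    rintro rfl
    norm_num at ha
  have ha3 : a ^ 3 = -1 := by linear_combination (a + 1) * ha
  have hinv : a⁻¹ = 1 - a := inv_eq_of_mul_eq_one_right (by linear_combination -ha)
  have hs2 : sigma (a ^ 2) = sigma a := by
    rw [sigma, sigma, ← inv_pow, hinv]
    ring
  have hu0 := hu 0
  have hZ : partitionFunctionCombined (n + 1) a u = sigma a *
      (∏ ν : Fin (2 * n), sigma (a * (u ν.succ.succ / u 1)⁻¹)) *
        partitionFunctionCombined n a fun ν => u ν.succ.succ := by
    rw [partitionFunctionCombined]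
    refine (partitionFunction_corner ?_).trans ?_
    · change a * (u 0 / u 1) = 1
      rw [h1]
      field_simp
    · rw [prod_fin_two_mul, hs2, mul_comm (∏ i : Fin n, _) (∏ i : Fin n, sigma (a * (_ / u 1)⁻¹)),
        ← mul_assoc]
      congr 3
      -- Row factors are brought to the form of column factors by `σ(-x⁻¹) = σ(x)` and `a ^ 3 = -1`.
      refine Finset.prod_congr rfl fun j _ => ?_
      have hw := hu (Fin.succ (Fin.succ ⟨2 * j.val + 1, by omega⟩))
      change sigma (a * (u 0 / u (Fin.succ (Fin.succ ⟨2 * j.val + 1, by omega⟩)))⁻¹) = _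
      generalize u (Fin.succ (Fin.succ ⟨2 * j.val + 1, _⟩)) = w at *
      have : a * (w / u 1)⁻¹ = -(a * (u 0 / w)⁻¹)⁻¹ := by
        rw [h1]
        field_simp
        exact ha3
      rw [this, sigma, sigma, inv_neg, inv_inv]
      ring
  have hS : sigmaProd u = -sigma a * (∏ ν : Fin (2 * n), sigma (u 0 * (u ν.succ.succ)⁻¹)) *
      (∏ ν : Fin (2 * n), sigma (u 1 * (u ν.succ.succ)⁻¹)) *
        sigmaProd fun ν => u ν.succ.succ := by
    rw [sigmaProd_succ, sigmaProd_succ, Fin.prod_univ_succ (n := 2 * n)]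
    have : u 0 * (u (Fin.succ 0))⁻¹ = a⁻¹ := by
      rw [Fin.succ_zero_eq_one, h1]
      field_simp
    rw [this, sigma_inv, Fin.succ_zero_eq_one, mul_assoc (_ * _)]
  have hprod : (∏ ν : Fin (2 * n), sigma (a * (u ν.succ.succ / u 1)⁻¹)) *
      (∏ ν : Fin (2 * n), sigma (u 0 * (u ν.succ.succ)⁻¹)) *
      (∏ ν : Fin (2 * n), sigma (u 1 * (u ν.succ.succ)⁻¹)) = u 0 ^ (6 * n) *
      ∏ ν : Fin (2 * n), ((u ν.succ.succ ^ 3)⁻¹ - (u 0 ^ 6)⁻¹ * u ν.succ.succ ^ 3) := by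
    have hc : u 0 ^ (6 * n) = ∏ ν : Fin (2 * n), (u 1) ^ 3 := by
      rw [Finset.prod_const, Finset.card_univ, Fintype.card_fin, h1, mul_pow, ha3, pow_mul,
        pow_mul]
      congr 1
      ring
    rw [hc, ← Finset.prod_mul_distrib, ← Finset.prod_mul_distrib, ← Finset.prod_mul_distrib]
    refine Finset.prod_congr rfl fun ν _ => ?_
    have hw := hu ν.succ.succ
    generalize u ν.succ.succ = w at *
    have h6 : u 1 ^ 6 = u 0 ^ 6 := by
      rw [h1, mul_pow, show a ^ 6 = (a ^ 3) ^ 2 by ring, ha3]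
      norm_num
    have h0 : u 0 = u 1 * a⁻¹ := by
      rw [h1]
      field_simp
    have hu1 := hu 1
    have := sigma_mul_sigma_mul_sigma ha (z := u 1 / w)
    rw [← h6, h0]
    convert! this using 1
    · congr 3
      · rw [inv_div]
      · ring
    · field_simp
  rw [DeterminantFormula] at h ⊢
  rw [hZ, hS, sign_step]
  refine Eq.trans ?_ (congrArg (_ * ·) (det_matrixP_corner ha hu h1).symm)
  have hsq : ((-1 : ℂ) ^ n) * (-1) ^ n = 1 := by
    rw [← mul_pow]
    norm_num
  calc _ = -sigma a ^ 2 * ((∏ ν : Fin (2 * n), sigma (a * (u ν.succ.succ / u 1)⁻¹)) *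
      (∏ ν : Fin (2 * n), sigma (u 0 * (u ν.succ.succ)⁻¹)) *
      (∏ ν : Fin (2 * n), sigma (u 1 * (u ν.succ.succ)⁻¹))) *
      ((partitionFunctionCombined n a fun ν => u ν.succ.succ) *
        sigmaProd fun ν => u ν.succ.succ) := by ring
    _ = _ := by
      rw [hprod, h]
      linear_combination (-sigma a ^ 2 * (u 0 ^ (6 * n) *
        ∏ ν : Fin (2 * n), ((u ν.succ.succ ^ 3)⁻¹ - (u 0 ^ 6)⁻¹ * u ν.succ.succ ^ 3)) *
        ((-1) ^ (n * (n - 1) / 2) * sigma a ^ n * (matrixP n fun ν => u ν.succ.succ).det)) *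
        (-hsq)

/-! ### Degree bounds and interpolation in the first parameter -/

theorem isLaurent_sigmaProd {m : ℕ} (u : Fin (m + 1) → ℂ) :
    IsLaurent m fun t => sigmaProd (Function.update u 0 t) := by
  simp only [sigmaProd_succ, Function.update_self, Function.update_of_ne (Fin.succ_ne_zero _)]
  have h : ∀ c : ℂ, IsLaurent 1 fun t => sigma (t * c⁻¹) := fun c => by
    convert! IsLaurent.linear c⁻¹ (-c) using 2 with x
    rw [sigma, mul_inv, inv_inv]
    ring
  simpa using (IsLaurent.prod Finset.univ fun (ν : Fin m) _ => h (u ν.succ)).mul (IsLaurent.const _)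

theorem isLaurent_det_matrixP {n : ℕ} (u : Fin (2 * n + 2) → ℂ) :
    IsLaurent (3 * n + 1) fun t =>
      (matrixP (n + 1) (Function.update u 0 t : Fin (2 * n + 2) → ℂ)).det := by
  have : ∀ t, (matrixP (n + 1) (Function.update u 0 t : Fin (2 * n + 2) → ℂ)).det = _ :=
    fun t => Matrix.det_succ_column_zero (n := 2 * n + 1) _
  simp only [this]
  refine IsLaurent.sum _ fun r _ => ?_
  have hsub : ∀ t, (matrixP (n + 1) (Function.update u 0 t : Fin (2 * n + 2) → ℂ)).submatrix
      r.succAbove Fin.succ = (matrixP (n + 1) u).submatrix r.succAbove Fin.succ := by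
    intro t
    ext i j
    simp [matrixP]
  simp only [hsub]
  have h0 : ∀ t, matrixP (n + 1) (Function.update u 0 t : Fin (2 * n + 2) → ℂ) r 0 =
      t ^ (((3 * n + 1 : ℕ) : ℤ) - 2 * (r.val + r.val / 2 : ℕ)) := by
    intro t
    have : (Function.update u 0 t : Fin (2 * n + 2) → ℂ) 0 = t := Function.update_self ..
    change (Function.update u 0 t : Fin (2 * n + 2) → ℂ) 0 ^ (_ : ℤ) = _
    rw [this]
    congr 1
    simp only [nonMultipleOfThree]
    push_cast
    ring
  -- The last row `r = 2n + 1` gives `r + r / 2 = 3n + 1`, so the bound is attained.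
  have hz := IsLaurent.zpow (d := 3 * n + 1) (r.val + r.val / 2) (by omega)
  simpa [h0] using (hz.const_mul ((-1) ^ r.val)).mul (IsLaurent.const _)

theorem isLaurent_partitionFunctionCombined {n : ℕ} (a : ℂ) (u : Fin (2 * n + 2) → ℂ) :
    IsLaurent n fun t =>
      partitionFunctionCombined (n + 1) a (Function.update u 0 t : Fin (2 * n + 2) → ℂ) := by
  have h : ∀ t,
      partitionFunctionCombined (n + 1) a (Function.update u 0 t : Fin (2 * n + 2) → ℂ) =
        partitionFunction (n + 1) a
          (Function.update (fun i : Fin (n + 1) => u ⟨2 * i.val, by omega⟩) 0 t)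
          (fun i => u ⟨2 * i.val + 1, by omega⟩) := by
    intro t
    unfold partitionFunctionCombined
    congr 1
    funext i
    refine Fin.cases ?_ (fun i => ?_) i
    · exact Function.update_self ..
    · rw [Function.update_of_ne (Fin.succ_ne_zero _)]
      exact Function.update_of_ne (by simp [Fin.ext_iff]) _ _
  simp only [h]
  exact isLaurent_partitionFunction a _ _

/-- Exchanging two vertical parameters fixes `Z` and multiplies `sigmaProd` and the determinant by
the same sign. Distinct sixth powers ensure `sigma (a ^ 2 * (y / y')) ≠ 0`, since `a ^ 12 = 1`. -/
theorem determinantFormula_of_swap {n : ℕ} {a : ℂ} (ha : a ^ 2 = a - 1) {u : Fin (2 * n + 2) → ℂ}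
    (hu : ∀ μ, u μ ≠ 0)
    (hne : ∀ i j : Fin (n + 1), i ≠ j →
      u ⟨2 * i.val + 1, by omega⟩ ^ 6 ≠ u ⟨2 * j.val + 1, by omega⟩ ^ 6)
    (j : Fin (n + 1))
    (h : DeterminantFormula a (n + 1)
      (u ∘ Equiv.swap (1 : Fin (2 * n + 2)) ⟨2 * j.val + 1, by omega⟩)) :
    DeterminantFormula a (n + 1) u := by
  have ha0 : a ≠ 0 := by
    rintro rfl
    norm_num at ha
  have ha3 : a ^ 3 = -1 := by linear_combination (a + 1) * ha
  set τ := Equiv.swap (1 : Fin (2 * n + 2)) ⟨2 * j.val + 1, by omega⟩ with hτ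
  have hZ : partitionFunctionCombined (n + 1) a (u ∘ τ) = partitionFunctionCombined (n + 1) a u := by
    have := partitionFunction_comp_perm (n := n + 1) (x := fun i => u ⟨2 * i.val, by omega⟩)
      (y := fun i => u ⟨2 * i.val + 1, by omega⟩) ha0 (fun _ => hu _) (fun _ => hu _)
      (fun i k hik h0 => ?_) (Equiv.swap 0 j)
    · refine Eq.trans ?_ this
      unfold partitionFunctionCombined
      congr 1
      · funext i
        refine congrArg u (Equiv.swap_apply_of_ne_of_ne (fun e => ?_) fun e => ?_)
        · have : 2 * i.val = 1 := (congrArg Fin.val e).trans (Fin.val_one _)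
          omega
        · have : 2 * i.val = 2 * j.val + 1 := congrArg Fin.val e
          omega
      · funext i
        let e : Fin (n + 1) → Fin (2 * n + 2) := fun i => ⟨2 * i.val + 1, by omega⟩
        have he : Function.Injective e := fun i k h => by
          have : 2 * i.val + 1 = 2 * k.val + 1 := congrArg Fin.val h
          omega
        exact congrArg u (he.swap_apply 0 j i)
    · rw [sigma_eq_zero_iff (mul_ne_zero (pow_ne_zero _ ha0) (div_ne_zero (hu _) (hu _)))] at h0
      refine hne i k hik ?_
      have hk := hu ⟨2 * k.val + 1, by omega⟩
      generalize u ⟨2 * i.val + 1, _⟩ = y at *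
      generalize u ⟨2 * k.val + 1, _⟩ = y' at *
      have : (a ^ 3) ^ 4 * (y / y') ^ 6 = 1 := by
        calc (a ^ 3) ^ 4 * (y / y') ^ 6 = ((a ^ 2 * (y / y')) ^ 2) ^ 3 := by ring
          _ = 1 := by rw [h0, one_pow]
      rw [ha3, div_pow] at this
      norm_num at this
      exact (div_eq_one_iff_eq (pow_ne_zero _ hk)).1 this
  have hS : sigmaProd (u ∘ τ) = (Equiv.Perm.sign τ : ℂ) * sigmaProd u := sigmaProd_comp_perm u τ
  have hD : (matrixP (n + 1) (u ∘ τ)).det = (Equiv.Perm.sign τ : ℂ) * (matrixP (n + 1) u).det :=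
    Matrix.det_permute' τ (matrixP (n + 1) u)
  have hsign : (Equiv.Perm.sign τ : ℂ) ≠ 0 := by
    rcases Int.units_eq_one_or (Equiv.Perm.sign τ) with h | h <;> rw [h] <;> norm_num
  rw [DeterminantFormula] at h ⊢
  refine mul_left_cancel₀ hsign ?_
  calc _ = partitionFunctionCombined (n + 1) a (u ∘ τ) * sigmaProd (u ∘ τ) := by
        rw [hZ, hS]
        exact mul_left_comm _ _ _
    _ = _ := by
        rw [h, hD]
        ring

/-- The determinant formula at generic parameters. -/
theorem determinantFormula_of_pow_six_ne {a : ℂ} (ha : a ^ 2 = a - 1) {n : ℕ}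
    (u : Fin (2 * n) → ℂ) (hu : ∀ μ, u μ ≠ 0) (hne : Function.Injective fun μ => u μ ^ 6) :
    DeterminantFormula a n u := by
  have ha0 : a ≠ 0 := by
    rintro rfl
    norm_num at ha
  have ha3 : a ^ 3 = -1 := by linear_combination (a + 1) * ha
  induction n with
  | zero =>
    simp [DeterminantFormula, partitionFunctionCombined, partitionFunction, sigmaProd,
      Orientation.weight]
    decide
  | succ n ih =>
    change Fin (2 * n + 2) → ℂ at u
    have hodd : ∀ i j : Fin (n + 1), i ≠ j →
        u ⟨2 * i.val + 1, by omega⟩ ^ 6 ≠ u ⟨2 * j.val + 1, by omega⟩ ^ 6 := by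
      intro i j hij h
      have := congrArg Fin.val (hne h)
      simp only at this
      omega
    let f : ℂ → ℂ := fun t =>
      partitionFunctionCombined (n + 1) a (Function.update u 0 t : Fin (2 * n + 2) → ℂ) *
        sigmaProd (Function.update u 0 t) -
      (-1) ^ ((n + 1) * (n + 1 - 1) / 2) * sigma a ^ (n + 1) *
        (matrixP (n + 1) (Function.update u 0 t : Fin (2 * n + 2) → ℂ)).det
    have hf : IsLaurent (3 * n + 1) f := by
      refine IsLaurent.sub ?_ ((isLaurent_det_matrixP u).const_mul _)
      rw [show 3 * n + 1 = n + (2 * n + 1) by ring]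
      exact (isLaurent_partitionFunctionCombined a u).mul (isLaurent_sigmaProd u)
    -- There are `(2n + 1) + (n + 1) = 3n + 2` nodes, one more than the degree bound.
    let z : Fin (2 * n + 1) ⊕ Fin (n + 1) → ℂ :=
      Sum.elim (fun ν => u ν.succ) (fun j => u ⟨2 * j.val + 1, by omega⟩ / a)
    have key : f (u 0) = 0 := by
      refine hf.eq_zero z ?_ ?_ ?_ ?_ (hu 0)
      · simp
        omega
      · rintro (ν | j)
        · exact hu _
        · exact div_ne_zero (hu _) ha0
      · have h6 : ∀ x y : ℂ, x ^ 2 = y ^ 2 → x ^ 6 = y ^ 6 := fun x y h => by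
          rw [show 6 = 2 * 3 by rfl, pow_mul, pow_mul, h]
        have hdiv : ∀ y : ℂ, (y / a) ^ 6 = y ^ 6 := fun y => by
          rw [div_pow, show a ^ 6 = (a ^ 3) ^ 2 by ring, ha3]
          norm_num
        -- Equal squares would give equal sixth powers, hence the same parameter, hence `a ^ 2 = 1`,
        -- against `a ^ 2 = a - 1`.
        have hmix : ∀ (ν : Fin (2 * n + 1)) (j : Fin (n + 1)),
            u ν.succ ^ 2 ≠ (u ⟨2 * j.val + 1, by omega⟩ / a) ^ 2 := by
          intro ν j h
          have h1 := h6 _ _ h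
          rw [hdiv] at h1
          rw [hne h1, div_pow] at h
          have := hu ⟨2 * j.val + 1, by omega⟩
          field_simp at h
          have ha1 : a = 2 := by linear_combination h - ha
          rw [ha1] at ha
          norm_num at ha
        rintro (ν | j) (ν' | j') h
        · exact congrArg _ (Fin.succ_injective _ (hne (h6 _ _ h)))
        · exact (hmix _ _ h).elim
        · exact (hmix _ _ h.symm).elim
        · have h1 := h6 _ _ h
          simp only [z, Sum.elim_inr, hdiv] at h1
          by_contra hjj
          exact hodd j j' (fun e => hjj (congrArg _ e)) h1
      · rintro (ν | j)
        · have h1 : sigmaProd (Function.update u 0 (u ν.succ)) = 0 := by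
            rw [sigmaProd_succ]
            refine mul_eq_zero_of_left (Finset.prod_eq_zero (Finset.mem_univ ν) ?_) _
            rw [Function.update_self, Function.update_of_ne (Fin.succ_ne_zero _),
              mul_inv_cancel₀ (hu _), sigma_one]
          have h2 : (matrixP (n + 1)
              (Function.update u 0 (u ν.succ) : Fin (2 * n + 2) → ℂ)).det = 0 := by
            refine Matrix.det_zero_of_column_eq (i := (0 : Fin (2 * n + 2))) (j := ν.succ)
              (Fin.succ_ne_zero _).symm fun k => ?_
            simp [matrixP]
          change _ * sigmaProd (Function.update u 0 (u ν.succ)) - _ * (matrixP (n + 1)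
              (Function.update u 0 (u ν.succ) : Fin (2 * n + 2) → ℂ)).det = 0
          rw [h1, h2, mul_zero, mul_zero, sub_zero]
        -- At `u 0 = y_j / a`, moving `y_j` to the first column yields the corner relation `u 1 = a
        -- * u 0`, and the induction hypothesis applies to the other `2n` parameters.
        · refine sub_eq_zero.2 ?_
          let v : Fin (2 * n + 2) → ℂ := Function.update u 0 (u ⟨2 * j.val + 1, by omega⟩ / a)
          have hv0 : v 0 = u ⟨2 * j.val + 1, by omega⟩ / a := Function.update_self ..
          have hv1 : ∀ μ ≠ 0, v μ = u μ := fun μ hμ => Function.update_of_ne hμ _ _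
          have hv : ∀ μ, v μ ≠ 0 := by
            intro μ
            by_cases hμ : μ = 0
            · rw [hμ, hv0]
              exact div_ne_zero (hu _) ha0
            · rw [hv1 μ hμ]
              exact hu μ
          change DeterminantFormula a (n + 1) v
          have hodd0 : ∀ i : Fin (n + 1), (⟨2 * i.val + 1, by omega⟩ : Fin (2 * n + 2)) ≠ 0 :=
            fun i h => Nat.succ_ne_zero _ (congrArg Fin.val h)
          have hj0 := hodd0 j
          have h01 : (1 : Fin (2 * n + 2)) ≠ 0 := one_ne_zero
          refine determinantFormula_of_swap ha hv (fun i k hik => ?_) j ?_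
          · rw [hv1 _ (hodd0 i), hv1 _ (hodd0 k)]
            exact hodd i k hik
          have hτ0 := Equiv.swap_apply_of_ne_of_ne h01.symm hj0.symm
          have hτ : ∀ ν : Fin (2 * n), Equiv.swap (1 : Fin (2 * n + 2)) ⟨2 * j.val + 1, by omega⟩
              ν.succ.succ ≠ 0 := by
            intro ν h
            exact Fin.succ_ne_zero _ ((Equiv.injective _) (h.trans hτ0.symm))
          refine determinantFormula_corner ha (fun μ => hv _) ?_ (ih _ (fun ν => hv _) ?_)
          · rw [Function.comp_apply, Function.comp_apply, Equiv.swap_apply_left, hτ0, hv0,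
              hv1 _ hj0]
            field_simp
          · intro ν ν' h
            simp only [Function.comp_apply, hv1 _ (hτ _)] at h
            exact Fin.succ_injective _ (Fin.succ_injective _ (Equiv.injective _ (hne h)))
    have := sub_eq_zero.1 key
    rw [Function.update_eq_self] at this
    exact this

/-! ### Extension to all nonzero parameters by continuity -/

theorem continuous_vertexWeight {f : ℝ → ℂ} (hf : Continuous f) (h0 : ∀ t, f t ≠ 0) (a : ℂ)
    (ha : a ≠ 0) (l r t b : Bool) : Continuous fun s => vertexWeight a (f s) l r t b := by
  have h1 : Continuous fun s => sigma (a * f s) := by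
    unfold sigma
    exact (continuous_const.mul hf).sub ((continuous_const.mul hf).inv₀
      fun t => mul_ne_zero ha (h0 t))
  have h2 : Continuous fun s => sigma (a * (f s)⁻¹) := by
    unfold sigma
    exact (continuous_const.mul (hf.inv₀ h0)).sub ((continuous_const.mul (hf.inv₀ h0)).inv₀
      fun t => mul_ne_zero ha (inv_ne_zero (h0 t)))
  cases l <;> cases r <;> cases t <;> cases b <;>
    simp only [vertexWeight, h1, h2, continuous_const]

/-- The determinant formula holds at all nonzero parameters. -/
theorem determinantFormula {a : ℂ} (ha : a ^ 2 = a - 1) {n : ℕ}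
    (u : Fin (2 * n) → ℂ) (hu : ∀ μ, u μ ≠ 0) : DeterminantFormula a n u := by
  have ha0 : a ≠ 0 := by
    rintro rfl
    norm_num at ha
  -- The moduli grow at different exponential rates, so two given sixth powers agree in modulus for
  -- at most one `t`. The parameters are thus generic off a finite set of `t`, and `t = 0` gives
  -- back `u`.
  let w : ℝ → Fin (2 * n) → ℂ := fun t μ => u μ * (Real.exp (μ.val * t) : ℝ)
  have hw : ∀ t μ, w t μ ≠ 0 := fun t μ => mul_ne_zero (hu μ) (by
    exact_mod_cast (Real.exp_pos _).ne')
  have hcont : ∀ μ, Continuous fun t => w t μ := fun μ => by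
    refine continuous_const.mul (Complex.continuous_ofReal.comp ?_)
    fun_prop
  have hfin : (⋃ p : {p : Fin (2 * n) × Fin (2 * n) // p.1 ≠ p.2},
      {t : ℝ | w t p.1.1 ^ 6 = w t p.1.2 ^ 6}).Finite := by
    refine Set.finite_iUnion fun ⟨⟨μ, ν⟩, hμν⟩ => Set.Subsingleton.finite fun s hs t ht => ?_
    have hlog : ∀ t : ℝ, w t μ ^ 6 = w t ν ^ 6 →
        Real.log ‖u μ‖ + μ.val * t = Real.log ‖u ν‖ + ν.val * t := by
      intro t ht
      have h1 := congrArg (fun x => Real.log ‖x‖) ht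
      have h2 : ∀ μ, Real.log ‖w t μ ^ 6‖ = 6 * (Real.log ‖u μ‖ + μ.val * t) := by
        intro μ
        rw [norm_pow, Real.log_pow, norm_mul, Complex.norm_real, Real.norm_eq_abs, Real.abs_exp,
          Real.log_mul (norm_ne_zero_iff.2 (hu μ)) (Real.exp_pos _).ne', Real.log_exp]
        norm_num
      simp only [h2] at h1
      linarith
    have h1 := hlog s hs
    have h2 := hlog t ht
    have h3 : ((μ.val : ℝ) - ν.val) * (s - t) = 0 := by linarith
    rcases mul_eq_zero.1 h3 with h | h
    · refine (hμν (Fin.ext ?_)).elim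
      exact_mod_cast sub_eq_zero.1 h
    · exact sub_eq_zero.1 h
  have hdense := hfin.countable.dense_compl ℝ
  have hL : Continuous fun t => partitionFunctionCombined n a (w t) * sigmaProd (w t) := by
    refine Continuous.mul ?_ ?_
    · refine continuous_finsetSum _ fun s _ => continuous_finsetProd _ fun i _ =>
        continuous_finsetProd _ fun j _ => continuous_vertexWeight ?_ ?_ a ha0 _ _ _ _
      · exact (hcont _).div (hcont _) fun t => hw t _
      · exact fun t => div_ne_zero (hw t _) (hw t _)
    · refine continuous_finsetProd _ fun i _ => continuous_finsetProd _ fun j _ => ?_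
      have h := (hcont i).mul ((hcont j).inv₀ fun t => hw t j)
      exact h.sub (h.inv₀ fun t => mul_ne_zero (hw t i) (inv_ne_zero (hw t j)))
  have hR : Continuous fun t =>
      (-1) ^ (n * (n - 1) / 2) * sigma a ^ n * (matrixP n (w t)).det := by
    refine continuous_const.mul (Continuous.matrix_det ?_)
    exact continuous_matrix fun i j => (hcont j).zpow₀ _ fun t => Or.inl (hw t j)
  have heq := Continuous.ext_on hdense hL hR fun t ht => by
    refine determinantFormula_of_pow_six_ne ha (w t) (hw t) fun μ ν h => ?_
    by_contra hμν
    exact ht (Set.mem_iUnion.2 ⟨⟨(μ, ν), hμν⟩, h⟩)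
  have h0 : w 0 = u := by
    funext μ
    simp [w]
  have := congrFun heq 0
  simp only [h0] at this
  exact this

end SquareIce

/-- For `a = exp(iπ/3)`, at all nonzero spectral parameters at which the denominator
`∏_{μ<ν} σ(u_μ / u_ν)` does not vanish. -/
theorem theoremt (n : ℕ) (a : ℂ) (ha : a = Complex.exp (Complex.I * Real.pi / 3))
    (u : Fin (2 * n) → ℂ) (hu : ∀ μ, u μ ≠ 0)
    (hne : ∀ μ ν, μ < ν → u μ ^ 2 ≠ u ν ^ 2) :
    SquareIce.partitionFunctionCombined n a u =
      (-1) ^ (n * (n - 1) / 2) *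
        (SquareIce.sigma a ^ n /
          ∏ μ : Fin (2 * n), ∏ ν ∈ Finset.Ioi μ, SquareIce.sigma (u μ * (u ν)⁻¹)) *
        (SquareIce.matrixP n u).det := by
  have ha2 : a ^ 2 = a - 1 := by
    have h3 : a ^ 3 = -1 := by
      rw [ha, ← Complex.exp_nat_mul, ← Complex.exp_pi_mul_I]
      congr 1
      push_cast
      ring
    -- As `a ^ 3 + 1 = (a + 1) * (a ^ 2 - a + 1)`, it remains to exclude `a = -1`; the real part of
    -- `a` is `1/2`.
    have h1 : a + 1 ≠ 0 := by
      intro h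
      have hre := congrArg Complex.re h
      rw [ha, show Complex.I * Real.pi / 3 = ((Real.pi / 3 : ℝ) : ℂ) * Complex.I by
        push_cast; ring, Complex.add_re, Complex.exp_ofReal_mul_I_re, Real.cos_pi_div_three] at hre
      norm_num at hre
    refine mul_left_cancel₀ h1 ?_
    linear_combination h3
  have hS : SquareIce.sigmaProd u ≠ 0 := by
    refine Finset.prod_ne_zero_iff.2 fun μ _ => Finset.prod_ne_zero_iff.2 fun ν hν => ?_
    rw [Ne, SquareIce.sigma_eq_zero_iff (mul_ne_zero (hu μ) (inv_ne_zero (hu ν))), mul_pow, inv_pow]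
    intro h
    exact hne μ ν (Finset.mem_Ioi.1 hν)
      (eq_of_div_eq_one (by rw [div_eq_mul_inv]; exact h))
  have h := SquareIce.determinantFormula ha2 u hu
  rw [SquareIce.DeterminantFormula, ← eq_div_iff hS] at h
  rw [h, SquareIce.sigmaProd]
  ring
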